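/- **Theorem 8.** Let $I\subseteq\mathbb R$ be a non-degenerate interval (open, closed or half-open, bounded or not) and let $f:I\to I$ be a continuous bitransitive map, i.e. $f^2$ is topologically transitive: for all nonempty relatively open $U,W\subseteq I$ there is $k\ge 1$ with $f^{2k}(U)\cap W\neq\emptyset$. Let $\mathcal M$ be an infinite set of positive integers, let $\beta=|I|$ if $I$ is bounded and $\beta=\infty$ otherwise, and let $$\delta=\inf_{n\ge 1}\ \sup_{x\in I}|f^n(x)-x|\in[0,\infty].$$ Let $\{v_1,v_2,\dots\}$ be a countably infinite subset of the closure of $I$ in $\mathbb R$, and let $\{x_1,x_2,\dots\}$ be a countably infinite subset of $I$ such that each $x_m$ has a finite $\omega$-limit point, i.e. there are $y\in\overline I$ and positive integers $n_1<n_2<\cdots$ with $f^{n_i}(x_m)\to y$. Terminology. A point is *totally transitive* if its orbit under $f^n$ is dense in $I$ for every $n\ge1$. A *Cantor set* is a nonempty compact, perfect, totally disconnected subset of $\mathbb R$. For $\gamma\in(0,\infty]$, a set $S\subseteq I$ with at least two points is a *$\gamma$-scrambled set of $f$* if $\liminf_{n\to\infty}|f^n(x)-f^n(y)|=0$ and $\limsup_{n\to\infty}|f^n(x)-f^n(y)|\ge\gamma$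 for all $x\ne y$ in $S$; it is *$\gamma$-scrambled with respect to $\mathcal M$* if this holds with both limits taken along $n\to\infty$, $n\in\mathcal M$. A set $C\subseteq I$ is *$\mathcal M$-synchronously proximal* to $v\in\mathbb R$ if there are $m_1<m_2<\cdots$ in $\mathcal M$ with $\operatorname{diam}(f^{m_i}(C)\cup\{v\})\to0$, and *dynamically synchronously proximal* to $v\in I$ if there are positive integers $n_1<n_2<\cdots$ with $\operatorname{diam} f^{n_i}(C\cup\{v\})\to0$. A set $A\subseteq I$ is *invariant* under a map $g$ if $g(A)\subseteq A$. Then $\delta>0$, and there are pairwise disjoint Cantor sets $\mathcal S^{(1)},\mathcal S^{(2)},\dots\subseteq I$ of totally transitive points of $f$ such that, with $\mathbb S=\bigcup_{j\ge1}\mathcal S^{(j)}$ and $\widehat{\mathbb S}=\bigcup_{i\ge0}f^i(\mathbb S)$: 1. every nonempty relatively open subset of $I$ contains infinitely many of the sets $\mathcal S^{(j)}$; 2. for every $\ell\ge1$, the set $\bigcup_{j=1}^{\ell}\mathcal S^{(j)}$ is $\mathcal M$-synchronously proximal to $v_m$ for every $m\ge1$, and dynamically synchronously proximal to $f^i(x_m)$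 for all $m\ge1$, $i\ge0$; 3. $\mathbb S$ is dense in $I$ and is a $\beta$-scrambled set of $f$ with respect to $\mathcal M$; 4. for every $x\in\bigcup_{i\ge0}f^i(\{x_1,x_2,\dots\})$ and every $c\in\widehat{\mathbb S}$, $$\liminf_{n\to\infty}|f^n(x)-f^n(c)|=0\quad\text{and}\quad\limsup_{n\to\infty}|f^n(x)-f^n(c)|\ge\tfrac{\beta}{2},$$ i.e. $\{x,c\}$ is a $\tfrac\beta2$-scrambled set of $f$; 5. for all $c\neq d$ in $\mathbb S$ and all $i\ge0$, $\displaystyle\limsup_{n\to\infty,\ n\in\mathcal M}|f^n(f^i(c))-f^n(f^i(d))|=\beta$; 6. $\widehat{\mathbb S}$ is dense in $I$, invariant under $f$, and a $\delta$-scrambled set of $f$ with respect to $\mathcal M$. Moreover, if $\mathcal M=\{n!:n\ge1\}$, then these sets can be chosen so that in addition, for every $n\ge1$, $\mathbb S$ is a dense $\beta$-scrambled set of $f^n$, and $\widehat{\mathbb S}$ is a dense $\delta$-scrambled set of $f^n$ that is invariant under $f^n$. -/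

import Mathlib

open Set Filter Topology
open scoped ENNReal

namespace IntervalDynamics

/-- `f` is topologically transitive: some positive iterate of any nonempty open set meets any
other nonempty open set. -/
def IsTransitive {X : Type*} [TopologicalSpace X] (f : X → X) : Prop :=
  ∀ U V : Set X, IsOpen U → U.Nonempty → IsOpen V → V.Nonempty →
    ∃ k : ℕ, 1 ≤ k ∧ ((f^[k] '' U) ∩ V).Nonempty

/-- `f` is bitransitive: its second iterate is transitive. -/
def IsBitransitive {X : Type*} [TopologicalSpace X] (f : X → X) : Prop :=
  IsTransitive (f^[2])

/-- `x` has a dense forward orbit under `f`. -/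
def IsTransitivePoint {X : Type*} [TopologicalSpace X] (f : X → X) (x : X) : Prop :=
  Dense (range fun i : ℕ => f^[i] x)

/-- `x` is a transitive point of `f^n` for every `n ≥ 1`. -/
def IsTotallyTransitivePoint {X : Type*} [TopologicalSpace X] (f : X → X) (x : X) : Prop :=
  ∀ n : ℕ, 1 ≤ n → IsTransitivePoint (f^[n]) x

/-- A (nonempty) compact, perfect, totally disconnected set of real numbers. -/
def IsCantorSet (C : Set ℝ) : Prop :=
  C.Nonempty ∧ IsCompact C ∧ Perfect C ∧ IsTotallyDisconnected C

/-- The filter on `ℕ` describing "`n → ∞` with `n ∈ M`". -/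
def atTopIn (M : Set ℕ) : Filter ℕ := atTop ⊓ 𝓟 M

/-- The length of an interval `I`, with value `∞` if `I` is unbounded. -/
noncomputable def len (I : Set ℝ) : ℝ≥0∞ :=
  open Classical in
  if Bornology.IsBounded I then ENNReal.ofReal (sSup I - sInf I) else ∞

/-- `inf_{n ≥ 1} sup_x |f^n(x) - x|`, possibly infinite. -/
noncomputable def infSupDisplacement {I : Set ℝ} (f : I → I) : ℝ≥0∞ :=
  ⨅ (n : ℕ) (_ : 1 ≤ n), ⨆ x : I, edist (f^[n] x) x

/-- `y` is a (finite) `ω`-limit point of `c`; it lies in the closure of `I` but not necessarily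
in `I`. -/
def IsOmegaLimitPoint {I : Set ℝ} (f : I → I) (c : I) (y : ℝ) : Prop :=
  y ∈ closure I ∧ ∃ n : ℕ → ℕ, StrictMono n ∧ (∀ i, 0 < n i) ∧
    Tendsto (fun i => ((f^[n i] c : I) : ℝ)) atTop (𝓝 y)

/-- `S` has at least two points and every pair of distinct points `x, y` of `S` satisfies
`liminf |f^n x - f^n y| = 0` and `limsup |f^n x - f^n y| ≥ β` as `n → ∞`. -/
def IsScrambled {I : Set ℝ} (f : I → I) (β : ℝ≥0∞) (S : Set I) : Prop :=
  S.Nontrivial ∧ ∀ x ∈ S, ∀ y ∈ S, x ≠ y →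
    liminf (fun n => edist (f^[n] x) (f^[n] y)) atTop = 0 ∧
    β ≤ limsup (fun n => edist (f^[n] x) (f^[n] y)) atTop

/-- As `IsScrambled`, with both limits taken along `n → ∞`, `n ∈ M`. -/
def IsScrambledWrt {I : Set ℝ} (f : I → I) (M : Set ℕ) (β : ℝ≥0∞) (S : Set I) : Prop :=
  S.Nontrivial ∧ ∀ x ∈ S, ∀ y ∈ S, x ≠ y →
    liminf (fun n => edist (f^[n] x) (f^[n] y)) (atTopIn M) = 0 ∧
    β ≤ limsup (fun n => edist (f^[n] x) (f^[n] y)) (atTopIn M)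

/-- `C` is `M`-synchronously proximal to the real number `v`: along some strictly increasing
sequence `m_i` in `M`, the diameter of `f^{m_i}(C) ∪ {v}` tends to zero. -/
def IsSyncProximal {I : Set ℝ} (f : I → I) (M : Set ℕ) (C : Set I) (v : ℝ) : Prop :=
  ∃ m : ℕ → ℕ, StrictMono m ∧ (∀ i, m i ∈ M) ∧
    Tendsto (fun i => Metric.ediam ((Subtype.val '' (f^[m i] '' C)) ∪ {v})) atTop (𝓝 0)

/-- `C` is dynamically synchronously proximal to the point `v` of `I`: along some strictly
increasing sequence of positive integers `n_i`, the diameter of `f^{n_i}(C ∪ {v})` tends to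
zero. -/
def IsDynSyncProximal {I : Set ℝ} (f : I → I) (C : Set I) (v : I) : Prop :=
  ∃ n : ℕ → ℕ, StrictMono n ∧ (∀ i, 0 < n i) ∧
    Tendsto (fun i => Metric.ediam (f^[n i] '' (C ∪ {v}))) atTop (𝓝 0)

/-- The union `⋃_{i ≥ 0} f^i(S)` of all forward images of `S`. -/
def forwardImages {X : Type*} (f : X → X) (S : Set X) : Set X :=
  ⋃ i : ℕ, f^[i] '' S

end IntervalDynamics

open IntervalDynamics

/-! For interval maps bitransitivity forces mixing. Periodic points are dense, so an open interval J
contains a periodic point p. Grouping the images f^j(J) by j modulo the period of p gives finitely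
many connected sets, because the images in one class share a point of the orbit of p. Their closures
cover I and are mapped cyclically into one another. All contain an interior fixed point z, and
tracking which are right or left neighbourhoods of z shows that each is I; transitivity of f^2
handles the case where f exchanges the two sides. So images of J in every residue class reach any
given periodic point, and mixing follows (`IsBitransitive.isMixing`).

The rest is Baire category. The sequences of continuous maps φ_j from the Cantor space to I form a
completely metrizable space, because I is Polish. For countably many infinite sets of times, a
generic φ is steerable: at arbitrarily late times in each set, finitely many cylinders go
simultaneously to arbitrary open targets (`IsMixing.exists_isSteerable`). The Cantor sets are the
ranges of the φ_j, and each claim is a choice of times and targets: a neighbourhood of z for liminf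
0, two points almost β apart for limsup β, a point that f^(j-i) moves by almost δ for orbits shifted
by i and j, and a point far from the ω-limit point for β/2. -/

namespace IntervalDynamics

/-! ### Transitive maps of topological spaces -/

section Transitivity

variable {X : Type*} [TopologicalSpace X] {f : X → X}

/-- `f` is topologically mixing: all large iterates of a nonempty open set meet any given
nonempty open set. -/
def IsMixing (f : X → X) : Prop :=
  ∀ U V : Set X, IsOpen U → U.Nonempty → IsOpen V → V.Nonempty →
    ∀ᶠ n : ℕ in atTop, ((f^[n] '' U) ∩ V).Nonempty

theorem IsTransitive.exists_iterate_mem (hf : IsTransitive f) {U V : Set X} (hU : IsOpen U)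
    (hU' : U.Nonempty) (hV : IsOpen V) (hV' : V.Nonempty) :
    ∃ k : ℕ, 1 ≤ k ∧ ∃ x ∈ U, f^[k] x ∈ V := by
  obtain ⟨k, hk, _, ⟨x, hx, rfl⟩, hxV⟩ := hf U V hU hU' hV hV'
  exact ⟨k, hk, x, hx, hxV⟩

theorem IsTransitive.of_iterate {n : ℕ} (hn : 1 ≤ n) (hf : IsTransitive (f^[n])) :
    IsTransitive f := by
  intro U V hU hU' hV hV'
  obtain ⟨k, hk, x, hx, hxV⟩ := hf.exists_iterate_mem hU hU' hV hV'
  rw [← Function.iterate_mul] at hxV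
  exact ⟨n * k, Nat.mul_pos hn hk, _, ⟨x, hx, rfl⟩, hxV⟩

theorem IsTransitive.eq_univ_of_mapsTo (hf : IsTransitive f) {P : Set X} (hP : IsClosed P)
    (hPi : (interior P).Nonempty) (hfP : MapsTo f P P) : P = univ := by
  by_contra hne
  obtain ⟨k, -, x, hx, hxP⟩ := hf.exists_iterate_mem isOpen_interior hPi hP.isOpen_compl
    (nonempty_compl.2 hne)
  exact hxP (hfP.iterate k (interior_subset hx))

theorem IsTransitive.denseRange [Nonempty X] (hf : IsTransitive f) : DenseRange f := by
  refine dense_iff_inter_open.2 fun V hV hV' => ?_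
  obtain ⟨k, hk, x, -, hxV⟩ := hf.exists_iterate_mem isOpen_univ univ_nonempty hV hV'
  obtain ⟨m, rfl⟩ := Nat.exists_eq_add_of_le' hk
  rw [Function.iterate_succ_apply'] at hxV
  exact ⟨_, hxV, mem_range_self _⟩

end Transitivity

/-! ### One-sided neighbourhoods given by intervals -/

section LinearOrder

variable {X : Type*} [LinearOrder X] [TopologicalSpace X] [OrderTopology X]

theorem mem_nhdsGE_of_ordConnected {S : Set X} (hS : S.OrdConnected) {z b : X} (hz : z ∈ S)
    (hb : b ∈ S) (hzb : z < b) : S ∈ 𝓝[≥] z :=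
  mem_of_superset (Icc_mem_nhdsGE hzb) (hS.out hz hb)

theorem mem_nhdsLE_of_ordConnected {S : Set X} (hS : S.OrdConnected) {z a : X} (hz : z ∈ S)
    (ha : a ∈ S) (haz : a < z) : S ∈ 𝓝[≤] z :=
  mem_of_superset (Icc_mem_nhdsLE haz) (hS.out ha hz)

theorem mem_nhdsGE_or_mem_nhdsLE {S : Set X} (hS : S.OrdConnected) (hS' : S.Nontrivial) {z : X}
    (hz : z ∈ S) : S ∈ 𝓝[≥] z ∨ S ∈ 𝓝[≤] z := by
  obtain ⟨w, hw, hne⟩ := hS'.exists_ne z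
  rcases hne.lt_or_gt with h | h
  · exact Or.inr (mem_nhdsLE_of_ordConnected hS hz hw h)
  · exact Or.inl (mem_nhdsGE_of_ordConnected hS hz hw h)

end LinearOrder

/-! ### Periodic and fixed points of transitive interval maps -/

section Order

variable {X : Type*} [ConditionallyCompleteLinearOrder X] [TopologicalSpace X] [OrderTopology X]
  [DenselyOrdered X] {f : X → X}

theorem exists_fixed_of_ordConnected {g : X → X} (hg : Continuous g) {s : Set X}
    (hs : s.OrdConnected) {x y : X} (hx : x ∈ s) (hy : y ∈ s) (hgx : g x ≤ x) (hgy : y ≤ g y) :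
    ∃ z ∈ s, g z = z :=
  hs.isPreconnected.intermediate_value₂ hx hy hg.continuousOn continuousOn_id hgx hgy

/-- In an interval without periodic points, a point that moves right under a return keeps to the
right of its initial position. -/
theorem lt_iterate_of_no_periodicPt (hf : Continuous f) {J : Set X} (hJ : J.OrdConnected)
    (hno : ∀ z ∈ J, ∀ n : ℕ, 1 ≤ n → f^[n] z ≠ z) {x : X} (hx : x ∈ J) {m : ℕ} (hm : 1 ≤ m)
    (hmx : f^[m] x ∈ J) (hlt : x < f^[m] x) {k : ℕ} (hk : 1 ≤ k) : x < f^[m * k] x := by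
  induction k, hk using Nat.le_induction with
  | base => simpa using hlt
  | succ k hk ih =>
    by_contra! hle
    -- `f^[m * k]` moves `x` to the right, but it sends `f^[m] x` to a point at or left of `x`; it
    -- therefore fixes a point of `J`.
    obtain ⟨z, hz, hfz⟩ := exists_fixed_of_ordConnected (hf.iterate (m * k)) hJ hmx hx
      (by rw [← Function.iterate_add_apply]; exact hle.trans hlt.le) ih.le
    exact hno z hz _ (Nat.mul_pos hm hk) hfz

theorem iterate_lt_of_no_periodicPt (hf : Continuous f) {J : Set X} (hJ : J.OrdConnected)
    (hno : ∀ z ∈ J, ∀ n : ℕ, 1 ≤ n → f^[n] z ≠ z) {x : X} (hx : x ∈ J) {m : ℕ} (hm : 1 ≤ m)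
    (hmx : f^[m] x ∈ J) (hlt : f^[m] x < x) {k : ℕ} (hk : 1 ≤ k) : f^[m * k] x < x := by
  induction k, hk using Nat.le_induction with
  | base => simpa using hlt
  | succ k hk ih =>
    by_contra! hle
    obtain ⟨z, hz, hfz⟩ := exists_fixed_of_ordConnected (hf.iterate (m * k)) hJ hx hmx
      ih.le (by rw [← Function.iterate_add_apply]; exact hlt.le.trans hle)
    exact hno z hz _ (Nat.mul_pos hm hk) hfz

/-- Cut the interval at `c`: some `x` returns from left to right after `m` steps, some `y` from
right to left after `n`. Without periodic points, `f^[m * n]` would still move `x` right and `y`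
left, hence fix a point of the interval. -/
theorem exists_periodicPt_mem_Ioo (hf : Continuous f) (ht : IsTransitive f) {a b : X}
    (hab : a < b) : ∃ p ∈ Ioo a b, ∃ k : ℕ, 1 ≤ k ∧ f^[k] p = p := by
  by_contra! hno
  obtain ⟨c, hac, hcb⟩ := exists_between hab
  obtain ⟨m, hm, x, hx, hmx⟩ := ht.exists_iterate_mem isOpen_Ioo (nonempty_Ioo.2 hac) isOpen_Ioo
    (nonempty_Ioo.2 hcb)
  obtain ⟨n, hn, y, hy, hny⟩ := ht.exists_iterate_mem isOpen_Ioo (nonempty_Ioo.2 hcb) isOpen_Ioo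
    (nonempty_Ioo.2 hac)
  have hl : Ioo a c ⊆ Ioo a b := Ioo_subset_Ioo_right hcb.le
  have hr : Ioo c b ⊆ Ioo a b := Ioo_subset_Ioo_left hac.le
  have h₁ := lt_iterate_of_no_periodicPt hf ordConnected_Ioo hno (hl hx) hm (hr hmx)
    (hx.2.trans hmx.1) hn
  have h₂ := iterate_lt_of_no_periodicPt hf ordConnected_Ioo hno (hr hy) hn (hl hny)
    (hny.2.trans hy.1) hm
  rw [mul_comm] at h₂
  obtain ⟨z, hz, hfz⟩ := exists_fixed_of_ordConnected (hf.iterate (m * n)) ordConnected_Ioo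
    (hr hy) (hl hx) h₂.le h₁.le
  exact hno z hz _ (Nat.mul_pos hm hn) hfz

/-- If `f` collapsed `J`, every later image of `J` would lie in the finite orbit of a periodic point
of `J`, whose complement is open and nonempty. -/
theorem nontrivial_image_of_isTransitive (hf : Continuous f) (ht : IsTransitive f) {J : Set X}
    (hJ : J.OrdConnected) (hJ' : J.Nontrivial) : (f '' J).Nontrivial := by
  by_contra hsub
  rw [not_nontrivial_iff] at hsub
  obtain ⟨a, ha, b, hb, hab⟩ := hJ'.exists_lt
  obtain ⟨p, hp, k, hk, hkp⟩ := exists_periodicPt_mem_Ioo hf ht hab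
  have hIJ : Ioo a b ⊆ J := Ioo_subset_Icc_self.trans (hJ.out ha hb)
  have hfin : ((fun i => f^[i] p) '' Iio k).Finite := (finite_Iio k).image _
  have hne : ((fun i => f^[i] p) '' Iio k)ᶜ.Nonempty := by
    obtain ⟨x, -, hx⟩ := (Ioo_infinite hab).exists_notMem_finite hfin
    exact ⟨x, hx⟩
  obtain ⟨n, hn, x, hx, hnx⟩ := ht.exists_iterate_mem isOpen_Ioo ⟨p, hp⟩
    hfin.isClosed.isOpen_compl hne
  apply hnx
  refine ⟨n % k, Nat.mod_lt _ hk, ?_⟩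
  have hper : Function.IsPeriodicPt f k p := hkp
  obtain ⟨m, rfl⟩ := Nat.exists_eq_add_of_le' hn
  simp only [hper.iterate_mod_apply, Function.iterate_succ_apply]
  rw [hsub (mem_image_of_mem f (hIJ hx)) (mem_image_of_mem f (hIJ hp))]

theorem ordConnected_image_of_continuous (hf : Continuous f) {J : Set X} (hJ : J.OrdConnected) :
    (f '' J).OrdConnected :=
  (hJ.isPreconnected.image f hf.continuousOn).ordConnected

section Nontrivial

variable [Nontrivial X]

theorem dense_setOf_exists_lt_and_lt : Dense {x : X | ∃ a b, a < x ∧ x < b} := by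
  refine dense_iff_inter_open.2 fun U hU hU' => ?_
  obtain ⟨a, b, hab, h⟩ := hU.exists_Ioo_subset hU'
  obtain ⟨c, hc⟩ := exists_between hab
  exact ⟨c, h hc, a, b, hc⟩

/-- A transitive interval map has a fixed point in the interior of the interval. -/
theorem exists_interior_fixedPt (hf : Continuous f) (ht : IsTransitive f) :
    ∃ z a b, a < z ∧ z < b ∧ f z = z := by
  obtain ⟨a, b, hab⟩ := exists_pair_lt X
  obtain ⟨c, hac, hcb⟩ := exists_between hab
  have h₁ : ∃ x ∈ {x : X | ∃ a b, a < x ∧ x < b}, f x ≤ x := by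
    by_contra! h
    have hle : ∀ x, x ≤ f x := fun x =>
      (isClosed_le continuous_id hf).closure_subset_iff.2 (fun x hx => (h x hx).le)
        (dense_setOf_exists_lt_and_lt x)
    obtain ⟨k, -, x, hx, hkx⟩ := ht.exists_iterate_mem isOpen_Ioi ⟨b, hcb⟩ isOpen_Iio ⟨a, hac⟩
    exact lt_irrefl _ (((show c < x from hx).trans_le
      (Function.id_le_iterate_of_id_le (f := f) hle k x)).trans hkx)
  have h₂ : ∃ x ∈ {x : X | ∃ a b, a < x ∧ x < b}, x ≤ f x := by
    by_contra! h
    have hle : ∀ x, f x ≤ x := fun x =>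
      (isClosed_le hf continuous_id).closure_subset_iff.2 (fun x hx => (h x hx).le)
        (dense_setOf_exists_lt_and_lt x)
    obtain ⟨k, -, x, hx, hkx⟩ := ht.exists_iterate_mem isOpen_Iio ⟨a, hac⟩ isOpen_Ioi ⟨b, hcb⟩
    exact lt_irrefl _ (((show x < c from hx).trans hkx).trans_le
      (Function.iterate_le_id_of_le_id (f := f) hle k x))
  obtain ⟨x, hx, hfx⟩ := h₁
  obtain ⟨y, hy, hfy⟩ := h₂
  have hoc : {x : X | ∃ a b, a < x ∧ x < b}.OrdConnected := by
    refine ⟨?_⟩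
    rintro x ⟨a, -, hax, -⟩ y ⟨-, b, -, hyb⟩ z hz
    exact ⟨a, b, hax.trans_le hz.1, hz.2.trans_lt hyb⟩
  obtain ⟨z, ⟨a, b, haz, hzb⟩, hfz⟩ := exists_fixed_of_ordConnected hf hoc hx hy hfx hfy
  exact ⟨z, a, b, haz, hzb, hfz⟩

end Nontrivial

theorem nonempty_interior_of_mem_nhdsGE {S : Set X} {z b : X} (hzb : z < b) (hS : S ∈ 𝓝[≥] z) :
    (interior S).Nonempty := by
  obtain ⟨u, hu, hSu⟩ := (mem_nhdsGE_iff_exists_Ico_subset' hzb).1 hS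
  exact (nonempty_Ioo.2 hu).mono (interior_maximal (Ioo_subset_Ico_self.trans hSu) isOpen_Ioo)

theorem nonempty_interior_of_mem_nhdsLE {S : Set X} {z a : X} (haz : a < z) (hS : S ∈ 𝓝[≤] z) :
    (interior S).Nonempty := by
  obtain ⟨u, hu, hSu⟩ := (mem_nhdsLE_iff_exists_Ioc_subset' haz).1 hS
  exact (nonempty_Ioo.2 hu).mono (interior_maximal (Ioo_subset_Ioc_self.trans hSu) isOpen_Ioo)

theorem nontrivial_of_nonempty_interior {S : Set X} [Nontrivial X] (hS : (interior S).Nonempty) :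
    S.Nontrivial := by
  obtain ⟨a, b, hab, h⟩ := isOpen_interior.exists_Ioo_subset hS
  exact ((Ioo_infinite hab).mono (h.trans interior_subset)).nontrivial

end Order

/-- If closed sets `A n` are permuted cyclically by a transitive map `f`, and an intersection of
some of them that has interior is respected by a transitive iterate of `f`, then all of them are
the whole space. -/
theorem eq_univ_of_cyclic {X : Type*} [TopologicalSpace X] [Nonempty X] {f : X → X}
    (ht : IsTransitive f) {k : ℕ}
    [NeZero k] {A : ZMod k → Set X} (hA : ∀ n, IsClosed (A n))
    (hfA : ∀ n, MapsTo f (A n) (A (n + 1))) {d : ℕ} (htd : IsTransitive (f^[d]))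
    {R : Set (ZMod k)} (hR : R.Nonempty) (hRd : ∀ n ∈ R, n + d ∈ R)
    (hint : (interior (⋂ n ∈ R, A n)).Nonempty) (n : ZMod k) : A n = univ := by
  have hiter : ∀ (j : ℕ) (n : ZMod k), MapsTo f^[j] (A n) (A (n + j)) := by
    intro j
    induction j with
    | zero => intro n; simpa using mapsTo_id _
    | succ j ih =>
      intro n
      rw [Function.iterate_succ']
      have := (hfA (n + j)).comp (ih n)
      rwa [add_assoc, ← Nat.cast_succ] at this
  have hRm : ∀ (m : ℕ), ∀ n ∈ R, n + m * d ∈ R := by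
    intro m
    induction m with
    | zero => simp
    | succ m ih =>
      intro n hn
      have := hRd _ (ih n hn)
      rwa [show n + m * d + d = n + (m + 1 : ℕ) * (d : ZMod k) by push_cast; ring] at this
  have hP : (⋂ n ∈ R, A n) = univ := by
    refine htd.eq_univ_of_mapsTo (isClosed_biInter fun n _ => hA n) hint fun x hx => ?_
    simp only [mem_iInter] at hx ⊢
    intro r hr
    -- `R` is only known to be closed under adding `d`; adding it `k - 1` times yields the
    -- predecessor `r - d`.
    have hk : ((k - 1 : ℕ) : ZMod k) = -1 := by
      rw [Nat.cast_pred (NeZero.pos k)]; simp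
    have := hiter d _ (hx _ (hRm (k - 1) r hr))
    rwa [hk, show r + -1 * (d : ZMod k) + d = r by ring] at this
  obtain ⟨r, hr⟩ := hR
  have hAr : A r = univ := by
    refine eq_univ_of_univ_subset ?_
    rw [← hP]
    exact biInter_subset_of_mem hr
  have hall : ∀ j : ℕ, A (r + j) = univ := by
    intro j
    induction j with
    | zero => simpa using hAr
    | succ j ih =>
      have h := hfA (r + j)
      rw [ih, mapsTo_univ_iff_range_subset] at h
      rw [Nat.cast_succ, ← add_assoc]
      exact eq_univ_of_univ_subset (ht.denseRange.closure_range ▸ (hA _).closure_subset_iff.2 h)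
  have := hall (n - r).val
  rwa [ZMod.natCast_zmod_val, add_sub_cancel] at this

/-! ### Bitransitive interval maps are mixing -/

section Mixing

variable {X : Type*} [ConditionallyCompleteLinearOrder X] [TopologicalSpace X] [OrderTopology X]
  [DenselyOrdered X] [Nontrivial X] {f : X → X}

/-- Closed intervals permuted cyclically by a bitransitive map and covering the space are all equal
to the whole space. -/
theorem IsBitransitive.eq_univ_of_cyclic_ordConnected (hf : Continuous f) (hbi : IsBitransitive f)
    {k : ℕ} [NeZero k] {A : ZMod k → Set X} (hA : ∀ n, IsClosed (A n))
    (hAc : ∀ n, (A n).OrdConnected)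
    (hfA : ∀ n, MapsTo f (A n) (A (n + 1))) (hcov : ⋃ n, A n = univ) (n : ZMod k) :
    A n = univ := by
  have ht : IsTransitive f := IsTransitive.of_iterate one_le_two hbi
  obtain ⟨z, a, b, haz, hzb, hfz⟩ := exists_interior_fixedPt hf ht
  have hmem : ∀ x, ∃ n, x ∈ A n := fun x => mem_iUnion.1 (hcov ▸ mem_univ x)
  have hz : ∀ n, z ∈ A n := by
    obtain ⟨r, hr⟩ := hmem z
    have : ∀ j : ℕ, z ∈ A (r + j) := by
      intro j
      induction j with
      | zero => simpa using hr
      | succ j ih =>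
        have := hfA _ ih
        rwa [hfz, add_assoc, ← Nat.cast_succ] at this
    intro n
    have := this (n - r).val
    rwa [ZMod.natCast_zmod_val, add_sub_cancel] at this
  have hinter : ∀ R : Set (ZMod k), (interior (⋂ n ∈ R, A n)).Nonempty →
      f '' (⋂ n ∈ R, A n) ∈ 𝓝[≥] z ∨ f '' (⋂ n ∈ R, A n) ∈ 𝓝[≤] z := by
    intro R hR
    have hoc : (⋂ n ∈ R, A n).OrdConnected := ordConnected_biInter fun n _ => hAc n
    refine mem_nhdsGE_or_mem_nhdsLE (ordConnected_image_of_continuous hf hoc)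
      (nontrivial_image_of_isTransitive hf ht hoc (nontrivial_of_nonempty_interior hR))
      ⟨z, mem_iInter₂.2 fun n _ => hz n, hfz⟩
  have hstep : ∀ R : Set (ZMod k), ∀ n ∈ R, f '' (⋂ n ∈ R, A n) ⊆ A (n + 1) := fun R n hn =>
    ((hfA n).mono_left (biInter_subset_of_mem hn)).image_subset
  set R : Set (ZMod k) := {n | A n ∈ 𝓝[≥] z} with hR
  set L : Set (ZMod k) := {n | A n ∈ 𝓝[≤] z} with hL
  have hRne : R.Nonempty := by
    obtain ⟨r, hr⟩ := hmem b
    exact ⟨r, mem_nhdsGE_of_ordConnected (hAc r) (hz r) hr hzb⟩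
  have hLne : L.Nonempty := by
    obtain ⟨r, hr⟩ := hmem a
    exact ⟨r, mem_nhdsLE_of_ordConnected (hAc r) (hz r) hr haz⟩
  have hRi : (interior (⋂ n ∈ R, A n)).Nonempty := nonempty_interior_of_mem_nhdsGE hzb
    ((biInter_mem R.toFinite).2 fun n hn => hn)
  have hLi : (interior (⋂ n ∈ L, A n)).Nonempty := nonempty_interior_of_mem_nhdsLE haz
    ((biInter_mem L.toFinite).2 fun n hn => hn)
  -- If `f` keeps one side of `z`, the corresponding index set is closed under adding 1. If it
  -- exchanges the sides, `R` is only closed under adding 2, and transitivity of `f^[2]` is needed.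
  rcases hinter R hRi with hRR | hRL
  · exact eq_univ_of_cyclic ht hA hfA (d := 1) ht hRne
      (fun n hn => mem_of_superset hRR (by simpa using hstep R n hn)) hRi n
  rcases hinter L hLi with hLR | hLL
  · refine eq_univ_of_cyclic ht hA hfA (d := 2) hbi hRne (fun n hn => ?_) hRi n
    have h₁ : n + 1 ∈ L := mem_of_superset hRL (hstep R n hn)
    have h₂ : n + 1 + 1 ∈ R := mem_of_superset hLR (hstep L _ h₁)
    rwa [add_assoc, one_add_one_eq_two] at h₂
  · exact eq_univ_of_cyclic ht hA hfA (d := 1) ht hLne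
      (fun n hn => mem_of_superset hLL (by simpa using hstep L n hn)) hLi n

/-- Along every residue class modulo the period, the images of an interval around a periodic point
form a dense interval. -/
theorem IsBitransitive.dense_iUnion_image (hf : Continuous f) (hbi : IsBitransitive f) {k : ℕ}
    [NeZero k] {J : Set X} (hJo : IsOpen J) (hJ : J.OrdConnected) {p : X} (hp : p ∈ J)
    (hkp : Function.IsPeriodicPt f k p) (n : ZMod k) :
    (⋃ j : {j : ℕ // (j : ZMod k) = n}, f^[j] '' J).OrdConnected ∧
      Dense (⋃ j : {j : ℕ // (j : ZMod k) = n}, f^[j] '' J) := by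
  have ht : IsTransitive f := IsTransitive.of_iterate one_le_two hbi
  let L : ZMod k → Set X := fun n => ⋃ j : {j : ℕ // (j : ZMod k) = n}, f^[j] '' J
  have hLconn : ∀ n, IsPreconnected (L n) := by
    intro n
    refine isPreconnected_iUnion ⟨f^[n.val] p, mem_iInter.2 ?_⟩ fun j =>
      hJ.isPreconnected.image _ (hf.iterate _).continuousOn
    rintro ⟨j, rfl⟩
    rw [ZMod.val_natCast, hkp.iterate_mod_apply]
    exact mem_image_of_mem _ hp
  have hLmaps : ∀ n, MapsTo f (L n) (L (n + 1)) := by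
    intro n x hx
    obtain ⟨⟨j, rfl⟩, y, hy, rfl⟩ := mem_iUnion.1 hx
    exact mem_iUnion.2 ⟨⟨j + 1, by push_cast; rfl⟩, y, hy, Function.iterate_succ_apply' f j y⟩
  have hcov : ⋃ n, closure (L n) = univ := by
    rw [← closure_iUnion_of_finite, ← dense_iff_closure_eq]
    refine dense_iff_inter_open.2 fun V hV hV' => ?_
    obtain ⟨j, -, x, hx, hjx⟩ := ht.exists_iterate_mem hJo ⟨p, hp⟩ hV hV'
    exact ⟨_, hjx, mem_iUnion.2 ⟨j, mem_iUnion.2 ⟨⟨j, rfl⟩, x, hx, rfl⟩⟩⟩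
  refine ⟨(hLconn n).ordConnected, dense_iff_closure_eq.2 ?_⟩
  exact hbi.eq_univ_of_cyclic_ordConnected hf (fun n => isClosed_closure)
    (fun n => (hLconn n).closure.ordConnected) (fun n => (hLmaps n).closure hf) hcov n

/-- For periodic `w` in `V`, each residue class modulo a common period contains some `j` with `w` in
`f^[j]` of the interval, since a dense interval contains every interior point. Adding multiples of
the period preserves this. -/
theorem IsBitransitive.isMixing (hf : Continuous f) (hbi : IsBitransitive f) : IsMixing f := by
  have ht : IsTransitive f := IsTransitive.of_iterate one_le_two hbi
  intro U V hU hU' hV hV'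
  obtain ⟨a, b, hab, hJU⟩ := hU.exists_Ioo_subset hU'
  obtain ⟨c, d, hcd, hJV⟩ := hV.exists_Ioo_subset hV'
  obtain ⟨p, hp, k, hk, hkp⟩ := exists_periodicPt_mem_Ioo hf ht hab
  obtain ⟨w, hw, l, hl, hlw⟩ := exists_periodicPt_mem_Ioo hf ht hcd
  have hpk : Function.IsPeriodicPt f (k * l) p := Function.IsPeriodicPt.mul_const hkp l
  have hwk : Function.IsPeriodicPt f (k * l) w := Function.IsPeriodicPt.const_mul hlw k
  have : NeZero (k * l) := ⟨(Nat.mul_pos hk hl).ne'⟩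
  have hex : ∀ n : ZMod (k * l), ∃ j : ℕ, (j : ZMod (k * l)) = n ∧ w ∈ f^[j] '' Ioo a b := by
    intro n
    obtain ⟨hoc, hd⟩ := hbi.dense_iUnion_image hf isOpen_Ioo ordConnected_Ioo hp hpk n
    obtain ⟨x, hxw, hx⟩ := hd.exists_mem_open isOpen_Iio ⟨c, hw.1⟩
    obtain ⟨y, hyw, hy⟩ := hd.exists_mem_open isOpen_Ioi ⟨d, hw.2⟩
    obtain ⟨⟨j, hj⟩, h⟩ := mem_iUnion.1 (hoc.out hxw hyw ⟨le_of_lt hx, le_of_lt hy⟩)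
    exact ⟨j, hj, h⟩
  choose j hj hjw using hex
  filter_upwards [eventually_ge_atTop (Finset.univ.sup j)] with n hn
  have hle : j n ≤ n := (Finset.le_sup (Finset.mem_univ _)).trans hn
  obtain ⟨x, hx, hjx⟩ := hjw n
  refine ⟨w, ⟨x, hJU hx, ?_⟩, hJV hw⟩
  obtain ⟨m, hm⟩ : k * l ∣ n - j n := by
    rw [← ZMod.natCast_eq_zero_iff, Nat.cast_sub hle, hj, sub_self]
  rw [← Nat.sub_add_cancel hle, Function.iterate_add_apply, hjx, hm]
  exact hwk.mul_const m

end Mixing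

/-! ### Generic sequences of maps from the Cantor space -/

section Generic

variable {X : Type*}

theorem IsMixing.eventually_forall_exists [TopologicalSpace X] {f : X → X} (hmix : IsMixing f)
    {α : Type*} [Finite α] {O W : α → Set X} (hO : ∀ a, IsOpen (O a)) (hO' : ∀ a, (O a).Nonempty)
    (hW : ∀ a, IsOpen (W a)) (hW' : ∀ a, (W a).Nonempty) :
    ∀ᶠ n : ℕ in atTop, ∀ a, ∃ x ∈ O a, f^[n] x ∈ W a := by
  refine eventually_all.2 fun a => ?_
  filter_upwards [hmix _ _ (hO a) (hO' a) (hW a) (hW' a)] with n hn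
  obtain ⟨_, ⟨x, hx, rfl⟩, hxW⟩ := hn
  exact ⟨x, hx, hxW⟩

/-- The restriction of a binary sequence to its first `n` terms. -/
def initialWord (n : ℕ) (x : ℕ → Bool) : Fin n → Bool := fun a => x a

theorem continuous_initialWord (n : ℕ) : Continuous (initialWord n) :=
  continuous_pi fun a => continuous_apply (a : ℕ)

theorem exists_forall_dist_lt_of_continuous [PseudoMetricSpace X] {Y : Type*} [MetricSpace Y]
    [CompactSpace Y] {g : Y → X} (hg : Continuous g) {ε : ℝ} (hε : 0 < ε) :
    ∃ δ > 0, ∀ x y, dist x y < δ → dist (g x) (g y) < ε := by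
  obtain ⟨δ, hδ, h⟩ := Metric.uniformContinuous_iff.1
    (CompactSpace.uniformContinuous_of_continuous hg) ε hε
  exact ⟨δ, hδ, fun x y => @h x y⟩

theorem exists_dist_lt_of_initialWord_eq [PseudoMetricSpace X] {ψ : (ℕ → Bool) → X}
    (hψ : Continuous ψ) {ε : ℝ} (hε : 0 < ε) :
    ∃ n₀, ∀ n ≥ n₀, ∀ x y, initialWord n x = initialWord n y → dist (ψ x) (ψ y) < ε := by
  obtain ⟨δ, hδ, h⟩ := @exists_forall_dist_lt_of_continuous X _ (ℕ → Bool)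
    (PiNat.metricSpace (E := fun _ => Bool)) inferInstance ψ hψ ε hε
  obtain ⟨n₀, hn₀⟩ := exists_pow_lt_of_lt_one hδ (one_half_lt_one (α := ℝ))
  refine ⟨n₀, fun n hn x y hxy => h x y (lt_of_le_of_lt ?_ hn₀)⟩
  refine (PiNat.mem_cylinder_iff_dist_le (E := fun _ => Bool)).1 fun a ha => ?_
  exact congrFun hxy ⟨a, ha.trans_le hn⟩

/-- Near any sequence of continuous maps from the Cantor space there are sequences whose first
terms are locally constant, with values that may be varied independently in open sets. -/
theorem exists_locallyConstant_mem [MetricSpace X] {𝒪 : Set (ℕ → C(ℕ → Bool, X))}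
    (h𝒪 : IsOpen 𝒪) (h𝒪' : 𝒪.Nonempty) (l₀ n₀ : ℕ) :
    ∃ l ≥ l₀, ∃ n ≥ n₀, ∃ O : Fin l × (Fin n → Bool) → Set X, (∀ a, IsOpen (O a)) ∧
      (∀ a, (O a).Nonempty) ∧ ∀ v : Fin l × (Fin n → Bool) → X, (∀ a, v a ∈ O a) →
        ∃ φ ∈ 𝒪, ∀ (j : Fin l) x, φ j x = v (j, initialWord n x) := by
  obtain ⟨ψ, hψ⟩ := h𝒪'
  obtain ⟨F, u, hu, hF⟩ := isOpen_pi_iff.1 h𝒪 ψ hψ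
  have hε : ∀ j, ∃ ε > 0, j ∈ F → Metric.ball (ψ j) ε ⊆ u j := by
    intro j
    by_cases hj : j ∈ F
    · obtain ⟨ε, hε, h⟩ := Metric.isOpen_iff.1 (hu j hj).1 _ (hu j hj).2
      exact ⟨ε, hε, fun _ => h⟩
    · exact ⟨1, one_pos, fun h => absurd h hj⟩
  choose ε hε hball using hε
  choose N hN using fun j =>
    exists_dist_lt_of_initialWord_eq (ψ j).continuous (half_pos (half_pos (hε j)))
  let n := max n₀ (F.sup N)
  let l := max l₀ (F.sup id + 1)
  let ext : (Fin n → Bool) → ℕ → Bool := fun σ a => if h : a < n then σ ⟨a, h⟩ else false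
  have hext : ∀ σ, initialWord n (ext σ) = σ := fun σ => by
    funext a
    simp [initialWord, ext]
  refine ⟨l, le_max_left _ _, n, le_max_left _ _,
    -- One quarter of ε for the choice of `v`, another for the oscillation of `ψ j` on a cylinder;
    -- the sum ε/2 leaves room for the supremum.
    fun a => Metric.ball (ψ a.1 (ext a.2)) (ε a.1 / 2 / 2), fun a => Metric.isOpen_ball,
    fun a => ⟨_, Metric.mem_ball_self (half_pos (half_pos (hε _)))⟩, fun v hv => ?_⟩
  refine ⟨fun j => if h : j < l then ⟨fun x => v (⟨j, h⟩, initialWord n x),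
    (continuous_of_discreteTopology (f := fun σ => v (⟨j, h⟩, σ))).comp
      (continuous_initialWord n)⟩ else ψ j, hF fun j hj => hball j hj ?_, fun j x => ?_⟩
  · have hjl : j < l := lt_of_lt_of_le (Nat.lt_succ_of_le (Finset.le_sup (f := id) hj))
      (le_max_right _ _)
    have hjn : N j ≤ n := (Finset.le_sup hj).trans (le_max_right _ _)
    rw [Metric.mem_ball]
    refine lt_of_le_of_lt ((ContinuousMap.dist_le (half_pos (hε j)).le).2 fun x => ?_)
      (half_lt_self (hε j))
    have h₁ := Metric.mem_ball.1 (hv (⟨j, hjl⟩, initialWord n x))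
    have h₂ := hN j n hjn (ext (initialWord n x)) x (hext _)
    simp only [hjl, dite_true, ContinuousMap.coe_mk]
    linarith [dist_triangle (v (⟨j, hjl⟩, initialWord n x)) (ψ j (ext (initialWord n x))) (ψ j x)]
  · simp

/-- Cylinders are compact, so each visit is an open condition in the compact-open topology. -/
theorem isOpen_setOf_exists_visit [TopologicalSpace X] {f : X → X} (hf : Continuous f) (T : Set ℕ)
    {l n : ℕ} {W : Fin l × (Fin n → Bool) → Set X} (hW : ∀ a, IsOpen (W a)) :
    IsOpen {φ : ℕ → C(ℕ → Bool, X) |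
      ∃ t ∈ T, ∀ (j : Fin l) x, f^[t] (φ j x) ∈ W (j, initialWord n x)} := by
  have : {φ : ℕ → C(ℕ → Bool, X) |
      ∃ t ∈ T, ∀ (j : Fin l) x, f^[t] (φ j x) ∈ W (j, initialWord n x)} =
      ⋃ t ∈ T, ⋂ a : Fin l × (Fin n → Bool), {φ | MapsTo (φ a.1)
        (initialWord n ⁻¹' {a.2}) (f^[t] ⁻¹' W a)} := by
    ext φ
    simp only [mem_ofPred_eq, mem_iUnion, mem_iInter, exists_prop]
    refine exists_congr fun t => and_congr_right fun _ => ⟨?_, ?_⟩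
    · rintro h ⟨j, σ⟩ x rfl
      exact h j x
    · exact fun h j x => h (j, initialWord n x) rfl
  rw [this]
  refine isOpen_biUnion fun t _ => isOpen_iInter_of_finite fun a => ?_
  exact (ContinuousMap.isOpen_setOfPred_mapsTo
    ((isClosed_singleton.preimage (continuous_initialWord n)).isCompact)
    ((hW a).preimage (hf.iterate t))).preimage
      (f := fun φ : ℕ → C(ℕ → Bool, X) => φ a.1) (continuous_apply (a.1 : ℕ))

theorem IsMixing.dense_setOf_exists_visit [MetricSpace X] {f : X → X} (hmix : IsMixing f)
    {T : Set ℕ} (hT : T.Infinite) {l n : ℕ} {W : Fin l × (Fin n → Bool) → Set X}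
    (hW : ∀ a, IsOpen (W a)) (hW' : ∀ a, (W a).Nonempty) :
    Dense {φ : ℕ → C(ℕ → Bool, X) |
      ∃ t ∈ T, ∀ (j : Fin l) x, f^[t] (φ j x) ∈ W (j, initialWord n x)} := by
  refine dense_iff_inter_open.2 fun 𝒪 h𝒪 h𝒪' => ?_
  obtain ⟨l', hl, n', hn, O, hO, hO', hφ⟩ := exists_locallyConstant_mem h𝒪 h𝒪' l n
  -- Targets are pulled back to the finer cylinders; indices from `l` on are unconstrained and get
  -- `O a` as a dummy target.
  let W' : Fin l' × (Fin n' → Bool) → Set X := fun a =>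
    if h : (a.1 : ℕ) < l then W (⟨a.1, h⟩, fun i => a.2 (Fin.castLE hn i)) else O a
  have hW₁ : ∀ a, IsOpen (W' a) := fun a => by
    by_cases h : (a.1 : ℕ) < l <;> simp [W', h, hW, hO]
  have hW₂ : ∀ a, (W' a).Nonempty := fun a => by
    by_cases h : (a.1 : ℕ) < l <;> simp [W', h, hW', hO']
  obtain ⟨t, htT, ht⟩ := ((Nat.frequently_atTop_iff_infinite.2 hT).and_eventually
    (hmix.eventually_forall_exists hO hO' hW₁ hW₂)).exists
  choose v hv hvW using ht
  obtain ⟨φ, hφO, hφv⟩ := hφ v hv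
  refine ⟨φ, hφO, t, htT, fun j x => ?_⟩
  have := hvW (Fin.castLE hl j, initialWord n' x)
  rw [← hφv] at this
  simp only [W', Fin.val_castLE, j.isLt, dite_true] at this
  exact this

/-- A basic open set restricts finitely many coordinates, so a later one may be replaced by a
constant map into `U`. -/
theorem dense_setOf_exists_range_subset [TopologicalSpace X] (N : ℕ) {U : Set X}
    (hU : U.Nonempty) : Dense {φ : ℕ → C(ℕ → Bool, X) | ∃ j ≥ N, MapsTo (φ j) univ U} := by
  refine dense_iff_inter_open.2 fun 𝒪 h𝒪 h𝒪' => ?_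
  obtain ⟨ψ, hψ⟩ := h𝒪'
  obtain ⟨u, hu⟩ := hU
  obtain ⟨F, w, hw, hF⟩ := isOpen_pi_iff.1 h𝒪 ψ hψ
  obtain ⟨j, hjN, hjF⟩ := (Ici_infinite N).exists_notMem_finset F
  refine ⟨Function.update ψ j (ContinuousMap.const _ u), hF fun i hi => ?_, j, hjN, fun x _ => ?_⟩
  · rw [Function.update_of_ne (ne_of_mem_of_not_mem hi hjF)]
    exact (hw i hi).2
  · simpa using hu

theorem isOpen_setOf_exists_range_subset [TopologicalSpace X] (N : ℕ) {U : Set X}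
    (hU : IsOpen U) : IsOpen {φ : ℕ → C(ℕ → Bool, X) | ∃ j ≥ N, MapsTo (φ j) univ U} := by
  simp only [ofPred_exists, ofPred_and]
  have : ∀ j, IsOpen {φ : ℕ → C(ℕ → Bool, X) | MapsTo (φ j) univ U} := fun j =>
    (ContinuousMap.isOpen_setOfPred_mapsTo isCompact_univ hU).preimage
      (f := fun φ : ℕ → C(ℕ → Bool, X) => φ j) (continuous_apply j)
  exact isOpen_iUnion fun j => isOpen_const.inter (this j)

/-- The maps `φ j` send the Cantor space into arbitrary open sets, and along every set of times in
`𝒩` (up to a shift) finitely many cylinders can be steered simultaneously to arbitrary targets. -/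
structure IsSteerable [TopologicalSpace X] (f : X → X) (𝒩 : Set (Set ℕ))
    (φ : ℕ → C(ℕ → Bool, X)) : Prop where
  infinite_range_subset : ∀ U : Set X, IsOpen U → U.Nonempty → {j | range (φ j) ⊆ U}.Infinite
  exists_visit : ∀ N ∈ 𝒩, ∀ (i l n : ℕ) (W : Fin l × (Fin n → Bool) → Set X),
    (∀ a, IsOpen (W a)) → (∀ a, (W a).Nonempty) →
      ∃ᶠ t in atTop, t ∈ N ∧ ∀ (j : Fin l) x, f^[t + i] (φ j x) ∈ W (j, initialWord n x)

theorem IsMixing.exists_visit_of_countable [MetricSpace X] [CompleteSpace X] [Nonempty X]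
    {f : X → X} (hf : Continuous f) (hmix : IsMixing f) {Q B : Type*} [Countable Q] [Countable B]
    {T : Q → Set ℕ} (hT : ∀ q, (T q).Infinite) {b : B → Set X} (hb : ∀ i, IsOpen (b i))
    (hb' : ∀ i, (b i).Nonempty) :
    ∃ φ : ℕ → C(ℕ → Bool, X), (∀ q l n (w : Fin l × (Fin n → Bool) → B),
      ∃ t ∈ T q, ∀ (j : Fin l) x, f^[t] (φ j x) ∈ b (w (j, initialWord n x))) ∧
      ∀ N i, ∃ j ≥ N, MapsTo (φ j) univ (b i) := by
  let G : Q × (Σ l : ℕ, Σ n : ℕ, Fin l × (Fin n → Bool) → B) ⊕ ℕ × B →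
      Set (ℕ → C(ℕ → Bool, X)) :=
    Sum.elim (fun q => {φ | ∃ t ∈ T q.1, ∀ (j : Fin q.2.1) x,
        f^[t] (φ j x) ∈ b (q.2.2.2 (j, initialWord q.2.2.1 x))})
      (fun q => {φ | ∃ j ≥ q.1, MapsTo (φ j) univ (b q.2)})
  have hGo : ∀ q, IsOpen (G q) := by
    rintro (⟨q, l, n, w⟩ | ⟨N, i⟩)
    · exact isOpen_setOf_exists_visit hf (T q) (W := fun a => b (w a)) fun a => hb _
    · exact isOpen_setOf_exists_range_subset N (hb i)
  have hGd : ∀ q, Dense (G q) := by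
    rintro (⟨q, l, n, w⟩ | ⟨N, i⟩)
    · exact hmix.dense_setOf_exists_visit (hT q) (W := fun a => b (w a)) (fun a => hb _)
        fun a => hb' _
    · exact dense_setOf_exists_range_subset N (hb' i)
  have : Nonempty (ℕ → C(ℕ → Bool, X)) :=
    ⟨fun _ => ContinuousMap.const _ (Classical.arbitrary X)⟩
  obtain ⟨φ, hφ⟩ := (dense_iInter_of_isOpen hGo hGd).nonempty
  rw [mem_iInter] at hφ
  exact ⟨φ, fun q l n w => hφ (Sum.inl (q, ⟨l, n, w⟩)), fun N i => hφ (Sum.inr (N, i))⟩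

theorem IsMixing.exists_isSteerable [TopologicalSpace X] [PolishSpace X] [Nonempty X]
    {f : X → X} (hf : Continuous f) (hmix : IsMixing f) {𝒩 : Set (Set ℕ)} (h𝒩 : 𝒩.Countable)
    (hinf : ∀ N ∈ 𝒩, N.Infinite) : ∃ φ, IsSteerable f 𝒩 φ := by
  let _ := TopologicalSpace.upgradeIsCompletelyMetrizable X
  have := h𝒩.to_subtype
  have hB := TopologicalSpace.isBasis_countableBasis X
  have := (TopologicalSpace.countable_countableBasis X).to_subtype
  have hsub : ∀ U : Set X, IsOpen U → U.Nonempty →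
      ∃ b : TopologicalSpace.countableBasis X, (b : Set X) ⊆ U := by
    rintro U hU ⟨x, hx⟩
    obtain ⟨b, hb, -, hbU⟩ := hB.exists_subset_of_mem_open hx hU
    exact ⟨⟨b, hb⟩, hbU⟩
  -- Shifted tails of the time sets: the shift gives `t + i`, the lower bound `s` gives visits at
  -- arbitrarily late times.
  have hT : ∀ q : 𝒩 × ℕ × ℕ, {t | ∃ m ∈ q.1.1, q.2.2 ≤ m ∧ t = m + q.2.1}.Infinite := by
    rintro ⟨⟨N, hN⟩, i, s⟩
    refine Set.infinite_of_forall_exists_gt fun a => ?_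
    obtain ⟨m, hm, hlt⟩ := (hinf N hN).exists_gt (max a s)
    exact ⟨m + i, ⟨m, hm, ((le_max_right _ _).trans_lt hlt).le, rfl⟩,
      ((le_max_left _ _).trans_lt hlt).trans_le (Nat.le_add_right _ _)⟩
  obtain ⟨φ, h₁, h₂⟩ := hmix.exists_visit_of_countable hf hT
    (fun b : TopologicalSpace.countableBasis X =>
      TopologicalSpace.isOpen_of_mem_countableBasis b.2)
    (fun b => TopologicalSpace.nonempty_of_mem_countableBasis b.2)
  refine ⟨φ, fun U hU hU' => ?_, fun N hN i l n W hW hW' => frequently_atTop.2 fun s => ?_⟩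
  · obtain ⟨b, hb⟩ := hsub U hU hU'
    refine Set.infinite_of_forall_exists_gt fun a => ?_
    obtain ⟨j, hj, hjU⟩ := h₂ (a + 1) b
    exact ⟨j, range_subset_iff.2 fun x => hb (hjU (mem_univ x)), hj⟩
  · choose w hw using fun a => hsub (W a) (hW a) (hW' a)
    obtain ⟨_, ⟨m, hm, hsm, rfl⟩, ht⟩ := h₁ (⟨N, hN⟩, i, s) l n w
    exact ⟨m, hsm, hm, fun j x => hw _ (ht j x)⟩

end Generic

/-! ### Intervals as Polish spaces, and their length -/

section Interval

/-- Only endpoints can be missing. Hence `I` is closed in an open subset of ℝ, which makes it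
Polish. -/
theorem finite_closure_diff_of_ordConnected {I : Set ℝ} (hI : I.OrdConnected) :
    (closure I \ I).Finite := by
  have hsub : closure I \ I ⊆ (closure I ∩ lowerBounds I) ∪ (closure I ∩ upperBounds I) := by
    rintro e ⟨he, heI⟩
    by_contra h
    simp only [mem_union, mem_inter_iff, he, true_and, not_or, mem_lowerBounds, mem_upperBounds,
      not_forall, not_le] at h
    obtain ⟨⟨a, ha, hae⟩, b, hb, heb⟩ := h
    exact heI (hI.out ha hb ⟨hae.le, heb.le⟩)
  refine Finite.subset (Finite.union (Subsingleton.finite ?_) (Subsingleton.finite ?_)) hsub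
  · rintro x ⟨hx, hx'⟩ y ⟨hy, hy'⟩
    rw [← lowerBounds_closure] at hx' hy'
    exact le_antisymm (hx' hy) (hy' hx)
  · rintro x ⟨hx, hx'⟩ y ⟨hy, hy'⟩
    rw [← upperBounds_closure] at hx' hy'
    exact le_antisymm (hy' hx) (hx' hy)

theorem polishSpace_of_ordConnected {I : Set ℝ} (hI : I.OrdConnected) : PolishSpace I := by
  have hopen : IsOpen (closure I \ I)ᶜ :=
    (finite_closure_diff_of_ordConnected hI).isClosed.isOpen_compl
  have hsub : I ⊆ (closure I \ I)ᶜ := fun x hx h => h.2 hx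
  have := hopen.polishSpace
  have hemb : IsClosedEmbedding (inclusion hsub) := by
    refine ⟨IsEmbedding.inclusion hsub, ?_⟩
    have : range (inclusion hsub) = Subtype.val ⁻¹' closure I := by
      rw [range_inclusion]
      ext ⟨x, hx⟩
      exact ⟨fun h => subset_closure h, fun h => by_contra fun h' => hx ⟨h, h'⟩⟩
    rw [this]
    exact isClosed_closure.preimage continuous_subtype_val
  exact hemb.polishSpace

theorem IsBitransitive.isMixing_and_exists_fixedPt {I : Set ℝ} (hI : I.OrdConnected)
    (hI' : I.Nontrivial) {f : I → I} (hf : Continuous f) (hbi : IsBitransitive f) :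
    IsMixing f ∧ ∃ z, f z = z := by
  have := hI
  have : Nontrivial I := hI'.coe_sort
  have : Inhabited I := ⟨⟨_, hI'.nonempty.some_mem⟩⟩
  obtain ⟨z, -, -, -, -, hz⟩ := exists_interior_fixedPt hf (IsTransitive.of_iterate one_le_two hbi)
  exact ⟨hbi.isMixing hf, z, hz⟩

theorem len_eq_ediam (I : Set ℝ) : len I = Metric.ediam I := by
  unfold len
  split_ifs with h
  · rw [Real.ediam_eq h]
  · rw [Metric.isBounded_iff_ediam_ne_top, not_not] at h
    exact h.symm

theorem edist_le_len {I : Set ℝ} (x y : I) : edist x y ≤ len I := by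
  rw [len_eq_ediam]
  exact Metric.edist_le_ediam_of_mem x.2 y.2

theorem len_pos {I : Set ℝ} (hI' : I.Nontrivial) : 0 < len I := by
  rw [len_eq_ediam]
  exact Metric.ediam_pos_iff.2 hI'

theorem exists_lt_edist_of_lt_len {I : Set ℝ} {b : ℝ≥0∞} (hb : b < len I) :
    ∃ x y : I, b < edist x y := by
  by_contra! h
  rw [len_eq_ediam] at hb
  exact hb.not_ge (Metric.ediam_le fun x hx y hy => h ⟨x, hx⟩ ⟨y, hy⟩)

theorem exists_lt_edist_of_lt_half_len {I : Set ℝ} {b : ℝ≥0∞} (hb : b < len I / 2) (y : ℝ) :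
    ∃ x : I, b < edist y (x : ℝ) := by
  by_contra! h
  have h2 : len I ≤ b + b := by
    rw [len_eq_ediam]
    refine Metric.ediam_le fun u hu v hv => (edist_triangle_left u v y).trans ?_
    exact add_le_add (h ⟨u, hu⟩) (h ⟨v, hv⟩)
  have : len I / 2 ≤ b := by
    rw [ENNReal.div_le_iff_le_mul (by simp) (by simp), mul_two]
    exact h2
  exact hb.not_ge this

end Interval

/-! ### Lower and upper limits from frequent events -/

section Limits

theorem liminf_eq_zero_of_frequently {F : Filter ℕ} {u : ℕ → ℝ≥0∞}
    (h : ∀ ε > 0, ∃ᶠ n in F, u n < ε) : liminf u F = 0 := by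
  refine le_antisymm (le_of_forall_gt_imp_ge_of_dense fun ε hε => ?_) zero_le
  exact liminf_le_of_frequently_le ((h ε hε).mono fun n => le_of_lt)

theorem le_limsup_of_frequently_lt {F : Filter ℕ} {u : ℕ → ℝ≥0∞} {β : ℝ≥0∞}
    (h : ∀ b < β, ∃ᶠ n in F, b < u n) : β ≤ limsup u F :=
  le_of_forall_lt_imp_le_of_dense fun b hb =>
    le_limsup_of_frequently_le ((h b hb).mono fun n => le_of_lt)

theorem frequently_atTopIn {M : Set ℕ} {p : ℕ → Prop} :
    (∃ᶠ n in atTopIn M, p n) ↔ ∃ᶠ n in atTop, n ∈ M ∧ p n := by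
  rw [atTopIn, frequently_inf_principal]

theorem atTopIn_le_atTop (M : Set ℕ) : atTopIn M ≤ atTop := inf_le_left

end Limits

/-! ### Displacement, Cantor sets and sets of times -/

theorem exists_isOpen_lt_edist {X Y : Type*} [TopologicalSpace X] [PseudoEMetricSpace Y]
    {g h : X → Y} (hg : Continuous g) (hh : Continuous h) {b : ℝ≥0∞} {x y : X}
    (hb : b < edist (g x) (h y)) :
    ∃ U V : Set X, IsOpen U ∧ IsOpen V ∧ x ∈ U ∧ y ∈ V ∧
      ∀ u ∈ U, ∀ v ∈ V, b < edist (g u) (h v) := by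
  have hopen : IsOpen {p : X × X | b < edist (g p.1) (h p.2)} :=
    isOpen_lt continuous_const ((hg.comp continuous_fst).edist (hh.comp continuous_snd))
  obtain ⟨U, V, hU, hV, hx, hy, hUV⟩ := isOpen_prod_iff.1 hopen x y hb
  exact ⟨U, V, hU, hV, hx, hy, fun u hu v hv => hUV (mk_mem_prod hu hv)⟩

/-- The displacement of all iterates of a mixing map is bounded away from zero. -/
theorem IsMixing.infSupDisplacement_pos {I : Set ℝ} (hI' : I.Nontrivial) {f : I → I}
    (hmix : IsMixing f) : 0 < infSupDisplacement f := by
  have := hI'.coe_sort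
  obtain ⟨a, b, hab⟩ := exists_pair_ne I
  obtain ⟨r, hr, hrab⟩ := exists_between (edist_pos.2 hab)
  obtain ⟨U, V, hU, hV, ha, hb, hUV⟩ := exists_isOpen_lt_edist continuous_id continuous_id hrab
  obtain ⟨N, hN⟩ := eventually_atTop.1 (hmix U V hU ⟨a, ha⟩ hV ⟨b, hb⟩)
  have hpos : ∀ n : ℕ, 1 ≤ n → 0 < ⨆ x : I, edist (f^[n] x) x := by
    intro n hn
    by_contra! h
    have hid : f^[n] = id := by
      funext x
      exact edist_le_zero.1 ((le_iSup (fun x : I => edist (f^[n] x) x) x).trans h)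
    -- If `f^[n]` were the identity, so would be its iterate at time `n * N ≥ N`, which carries a
    -- point of `U` into `V`.
    obtain ⟨_, ⟨x, hx, rfl⟩, hxV⟩ := hN (n * N) (Nat.le_mul_of_pos_left N hn)
    rw [Function.iterate_mul, hid, Function.iterate_id] at hxV
    simpa using hUV x hx x hxV
  have hmin : 0 < r ⊓ ((Finset.range N).filter (1 ≤ ·)).inf
      fun n => ⨆ x : I, edist (f^[n] x) x := by
    refine lt_min hr ((Finset.lt_inf_iff ENNReal.zero_lt_top).2 fun n hn => hpos n ?_)
    exact (Finset.mem_filter.1 hn).2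
  refine hmin.trans_le (le_iInf₂ fun n hn => ?_)
  rcases lt_or_ge n N with h | h
  · exact inf_le_right.trans (Finset.inf_le (Finset.mem_filter.2 ⟨Finset.mem_range.2 h, hn⟩))
  · obtain ⟨_, ⟨x, hx, rfl⟩, hxV⟩ := hN n h
    refine inf_le_left.trans (le_trans ?_ (le_iSup (fun x : I => edist (f^[n] x) x) x))
    rw [edist_comm]
    exact (hUV x hx _ hxV).le

theorem exists_ne_initialWord {p q : ℕ × (ℕ → Bool)} (hpq : p ≠ q) :
    ∃ n, (p.1, initialWord n p.2) ≠ (q.1, initialWord n q.2) := by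
  by_contra! h
  refine hpq (Prod.ext (Prod.mk.inj (h 0)).1 (funext fun a => ?_))
  exact congrFun (Prod.mk.inj (h (a + 1))).2 ⟨a, a.lt_succ_self⟩

theorem isCantorSet_range {g : (ℕ → Bool) → ℝ} (hg : Continuous g) (hinj : Function.Injective g) :
    IsCantorSet (range g) := by
  have hemb : IsClosedEmbedding g := hg.isClosedEmbedding hinj
  refine ⟨range_nonempty g, isCompact_range hg, ⟨(isCompact_range hg).isClosed, ?_⟩,
    hemb.isEmbedding.isTotallyDisconnected_range.2 inferInstance⟩
  refine preperfect_iff_nhds.2 ?_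
  rintro _ ⟨x, rfl⟩ U hU
  -- Flipping one ever later bit of `x` gives distinct nearby points, so no point is isolated.
  have hlim : Tendsto (fun n => Function.update x n (!x n)) atTop (𝓝 x) := by
    refine tendsto_pi_nhds.2 fun a => tendsto_const_nhds.congr' ?_
    filter_upwards [eventually_gt_atTop a] with n hn
    rw [Function.update_of_ne hn.ne]
  obtain ⟨n, hn⟩ := (((hg.tendsto x).comp hlim).eventually_mem hU).exists
  refine ⟨_, ⟨hn, mem_range_self _⟩, fun h => ?_⟩
  have := congrFun (hinj h) n
  simp at this

theorem exists_strictMono_tendsto_zero {u : ℕ → ℝ≥0∞} {p : ℕ → Prop}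
    (h : ∀ ε > 0, ∃ᶠ t in atTop, p t ∧ u t ≤ ε) :
    ∃ m : ℕ → ℕ, StrictMono m ∧ (∀ i, p (m i)) ∧ Tendsto (fun i => u (m i)) atTop (𝓝 0) := by
  obtain ⟨m, hm, hpm⟩ := extraction_forall_of_frequently
    -- At `n = 0` the bound is `∞`, which is harmless.
    fun n : ℕ => h (n : ℝ≥0∞)⁻¹ (ENNReal.inv_pos.2 (ENNReal.natCast_ne_top n))
  exact ⟨m, hm, fun i => (hpm i).1, tendsto_of_tendsto_of_tendsto_of_le_of_le tendsto_const_nhds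
    ENNReal.tendsto_inv_nat_nhds_zero (fun _ => zero_le) fun i => (hpm i).2⟩

theorem ediam_le_of_subset_eball {X : Type*} [PseudoEMetricSpace X] {s : Set X} {x : X}
    {ε : ℝ≥0∞} (h : s ⊆ Metric.eball x (ε / 2)) : Metric.ediam s ≤ ε :=
  ((Metric.ediam_mono h).trans Metric.ediam_eball_le).trans
    (ENNReal.mul_div_cancel two_ne_zero ENNReal.ofNat_ne_top).le

theorem isOpen_and_nonempty_preimage_eball {I : Set ℝ} {y : ℝ} (hy : y ∈ closure I) {ε : ℝ≥0∞}
    (hε : 0 < ε) : IsOpen ((↑) ⁻¹' Metric.eball y ε : Set I) ∧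
      ((↑) ⁻¹' Metric.eball y ε : Set I).Nonempty := by
  refine ⟨Metric.isOpen_eball.preimage continuous_subtype_val, ?_⟩
  obtain ⟨x, hx, hxI⟩ := mem_closure_iff.1 hy _ Metric.isOpen_eball (Metric.mem_eball_self hε)
  exact ⟨⟨x, hxI⟩, hx⟩

/-- An orbit with an `ω`-limit point converges to it along an infinite set of times, also after a
shift. -/
theorem IsOmegaLimitPoint.exists_tendsto {I : Set ℝ} {f : I → I} {x : I} {y : ℝ}
    (h : IsOmegaLimitPoint f x y) (j : ℕ) :
    ∃ N : Set ℕ, N.Infinite ∧ Tendsto (fun t => (f^[t + j] x : ℝ)) (atTopIn N) (𝓝 y) := by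
  obtain ⟨-, n, hn, -, hlim⟩ := h
  refine ⟨{t | ∃ k, t + j = n k}, Set.infinite_of_forall_exists_gt fun a => ?_, ?_⟩
  · have hle := hn.le_apply (x := a + j + 1)
    exact ⟨n (a + j + 1) - j, ⟨a + j + 1, by omega⟩, by omega⟩
  · intro s hs
    obtain ⟨K, hK⟩ := eventually_atTop.1 (hlim.eventually_mem hs)
    refine eventually_inf_principal.2 ?_
    filter_upwards [eventually_ge_atTop (n K)] with t ht
    rintro ⟨k, hk⟩
    have hKk : K ≤ k := hn.le_iff_le.1 (by omega)
    simpa [hk] using hK k hKk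

/-- Large factorials are large multiples of `n`, so limits along factorials control limits for
`f^[n]`. -/
theorem atTopIn_factorial_le_map {n : ℕ} (hn : 1 ≤ n) :
    atTopIn {k | ∃ n : ℕ, 1 ≤ n ∧ k = n.factorial} ≤ map (n * ·) atTop := by
  intro s hs
  obtain ⟨K, hK⟩ := mem_atTop_sets.1 (mem_map.1 hs)
  refine eventually_inf_principal.2 ?_
  filter_upwards [eventually_ge_atTop (n * K), eventually_gt_atTop n.factorial] with m hm hm'
  rintro ⟨q, -, rfl⟩
  have hnq : n ≤ q := by
    by_contra! h
    exact hm'.not_ge (Nat.factorial_le h.le)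
  obtain ⟨k, hk⟩ := Nat.dvd_factorial hn hnq
  rw [hk] at hm ⊢
  exact hK k (Nat.le_of_mul_le_mul_left hm hn)

theorem IsScrambledWrt.isScrambled_iterate {I : Set ℝ} {f : I → I} {β : ℝ≥0∞} {S : Set I}
    (h : IsScrambledWrt f {k | ∃ n : ℕ, 1 ≤ n ∧ k = n.factorial} β S) {n : ℕ} (hn : 1 ≤ n) :
    IsScrambled (f^[n]) β S := by
  refine ⟨h.1, fun x hx y hy hxy => ?_⟩
  obtain ⟨h₁, h₂⟩ := h.2 x hx y hy hxy
  simp only [← Function.iterate_mul]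
  have hle := atTopIn_factorial_le_map hn
  refine ⟨le_antisymm ?_ zero_le, ?_⟩
  · exact (liminf_le_liminf_of_le (u := fun n => edist (f^[n] x) (f^[n] y)) hle).trans h₁.le
  · exact h₂.trans (limsup_le_limsup_of_le (u := fun n => edist (f^[n] x) (f^[n] y)) hle)

theorem isScrambled_pair {I : Set ℝ} {f : I → I} {β : ℝ≥0∞} (hβ : 0 < β) {x c : I}
    (h₁ : liminf (fun n => edist (f^[n] x) (f^[n] c)) atTop = 0)
    (h₂ : β ≤ limsup (fun n => edist (f^[n] x) (f^[n] c)) atTop) : IsScrambled f β {x, c} := by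
  have hne : x ≠ c := by
    rintro rfl
    simp only [edist_self, limsup_const] at h₂
    exact hβ.not_ge h₂
  refine ⟨nontrivial_pair hne, ?_⟩
  rintro a (rfl | rfl) b (rfl | rfl) hab
  · exact absurd rfl hab
  · exact ⟨h₁, h₂⟩
  · simp only [edist_comm (f^[_] a)]
    exact ⟨h₁, h₂⟩
  · exact absurd rfl hab

theorem infSupDisplacement_le_len {I : Set ℝ} (f : I → I) : infSupDisplacement f ≤ len I :=
  (iInf₂_le 1 le_rfl).trans (iSup_le fun _ => edist_le_len _ _)

/-! ### Dynamical consequences of steerability -/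

namespace IsSteerable

section

variable {X : Type*} [TopologicalSpace X] {f : X → X} {𝒩 : Set (Set ℕ)} {N : Set ℕ}
  {φ : ℕ → C(ℕ → Bool, X)}

theorem frequently_forall_mem (h : IsSteerable f 𝒩 φ) (hN : N ∈ 𝒩) (i l : ℕ) {W : Set X}
    (hW : IsOpen W) (hW' : W.Nonempty) :
    ∃ᶠ t in atTopIn N, ∀ j < l, ∀ x, f^[t + i] (φ j x) ∈ W :=
  frequently_atTopIn.2 <| (h.exists_visit N hN i l 0 (fun _ => W) (fun _ => hW)
    fun _ => hW').mono fun _ ht => ⟨ht.1, fun j hj => ht.2 ⟨j, hj⟩⟩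

/-- Distinct parameters differ in the index or in a finite initial word, so they can be given
independent targets. -/
theorem frequently_mem_and_mem (h : IsSteerable f 𝒩 φ) (hN : N ∈ 𝒩) (i : ℕ)
    {p q : ℕ × (ℕ → Bool)} (hpq : p ≠ q) {U V : Set X} (hU : IsOpen U) (hU' : U.Nonempty)
    (hV : IsOpen V) (hV' : V.Nonempty) :
    ∃ᶠ t in atTopIn N, f^[t + i] (φ p.1 p.2) ∈ U ∧ f^[t + i] (φ q.1 q.2) ∈ V := by
  classical
  obtain ⟨n, hn⟩ := exists_ne_initialWord hpq
  let W : Fin (max p.1 q.1 + 1) × (Fin n → Bool) → Set X := fun a =>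
    if ((a.1 : ℕ), a.2) = (p.1, initialWord n p.2) then U else V
  have hW : ∀ a, IsOpen (W a) := fun a => by
    simp only [W]; split_ifs <;> assumption
  have hW' : ∀ a, (W a).Nonempty := fun a => by
    simp only [W]; split_ifs <;> assumption
  refine frequently_atTopIn.2 ((h.exists_visit N hN i _ n W hW hW').mono fun t ht => ⟨ht.1, ?_⟩)
  have hp := ht.2 ⟨p.1, Nat.lt_succ_of_le (le_max_left _ _)⟩ p.2
  have hq := ht.2 ⟨q.1, Nat.lt_succ_of_le (le_max_right _ _)⟩ q.2
  simp only [W, if_true] at hp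
  simp only [W, if_neg hn.symm] at hq
  exact ⟨hp, hq⟩

theorem isTotallyTransitivePoint (h : IsSteerable f 𝒩 φ)
    (h𝒩 : ∀ n : ℕ, 1 ≤ n → {t | n ∣ t} ∈ 𝒩) (j : ℕ) (x : ℕ → Bool) :
    IsTotallyTransitivePoint f (φ j x) := by
  intro n hn
  refine dense_iff_inter_open.2 fun U hU hU' => ?_
  obtain ⟨t, ⟨k, rfl⟩, ht⟩ := (frequently_atTopIn.1
    (h.frequently_forall_mem (h𝒩 n hn) 0 (j + 1) hU hU')).exists
  refine ⟨_, ht j j.lt_succ_self x, k, ?_⟩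
  simp only [add_zero, Function.iterate_mul]

theorem dense_iUnion_range (h : IsSteerable f 𝒩 φ) : Dense (⋃ j, range (φ j)) := by
  refine dense_iff_inter_open.2 fun U hU hU' => ?_
  obtain ⟨j, hj⟩ := (h.infinite_range_subset U hU hU').nonempty
  exact ⟨φ j default, hj (mem_range_self _), mem_iUnion.2 ⟨j, mem_range_self _⟩⟩

end

variable {I : Set ℝ} {f : I → I} {𝒩 : Set (Set ℕ)} {M N : Set ℕ} {φ : ℕ → C(ℕ → Bool, I)}

theorem len_le_limsup (h : IsSteerable f 𝒩 φ) (hN : N ∈ 𝒩) (i : ℕ) {p q : ℕ × (ℕ → Bool)}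
    (hpq : p ≠ q) :
    len I ≤ limsup (fun n => edist (f^[n + i] (φ p.1 p.2)) (f^[n + i] (φ q.1 q.2)))
      (atTopIn N) := by
  refine le_limsup_of_frequently_lt fun b hb => ?_
  obtain ⟨x, y, hxy⟩ := exists_lt_edist_of_lt_len hb
  obtain ⟨U, V, hU, hV, hx, hy, hUV⟩ := exists_isOpen_lt_edist continuous_id continuous_id hxy
  exact (h.frequently_mem_and_mem hN i hpq hU ⟨x, hx⟩ hV ⟨y, hy⟩).mono fun t ht =>
    hUV _ ht.1 _ ht.2

/-- Coinciding points would have upper distance 0, not the positive length of `I`. Disjointness of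
the ranges follows too. -/
theorem injective (h : IsSteerable f 𝒩 φ) (hN : N ∈ 𝒩) (hI : I.Nontrivial) :
    Function.Injective fun p : ℕ × (ℕ → Bool) => φ p.1 p.2 := by
  intro p q hpq
  by_contra hne
  have := h.len_le_limsup hN 0 hne
  simp only [hpq, edist_self] at this
  have hle : limsup (fun _ : ℕ => (0 : ℝ≥0∞)) (atTopIn N) ≤ 0 :=
    limsup_le_of_le (h := Eventually.of_forall fun _ => le_rfl)
  exact (len_pos hI).not_ge (this.trans hle)

theorem isSyncProximal (h : IsSteerable f 𝒩 φ) (hM : M ∈ 𝒩) (l : ℕ) {v : ℝ}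
    (hv : v ∈ closure I) : IsSyncProximal f M (⋃ j < l, range (φ j)) v := by
  refine exists_strictMono_tendsto_zero (p := (· ∈ M)) (u := fun t =>
    Metric.ediam ((Subtype.val '' (f^[t] '' ⋃ j < l, range (φ j))) ∪ {v})) fun ε hε => ?_
  have hε2 : 0 < ε / 2 := ENNReal.half_pos hε.ne'
  obtain ⟨hW, hW'⟩ := isOpen_and_nonempty_preimage_eball hv hε2
  refine (frequently_atTopIn.1 (h.frequently_forall_mem hM 0 l hW hW')).mono
    fun t ht => ⟨ht.1, ediam_le_of_subset_eball (x := v) (union_subset ?_ ?_)⟩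
  · rintro _ ⟨_, ⟨c, hc, rfl⟩, rfl⟩
    simp only [mem_iUnion] at hc
    obtain ⟨j, hj, x, rfl⟩ := hc
    exact ht.2 j hj x
  · exact singleton_subset_iff.2 (Metric.mem_eball_self hε2)

theorem isDynSyncProximal (h : IsSteerable f 𝒩 φ) (hN : N ∈ 𝒩) (l : ℕ) {x : I} {y : ℝ}
    (hy : y ∈ closure I) {i : ℕ}
    (hlim : Tendsto (fun t => (f^[t + i] x : ℝ)) (atTopIn N) (𝓝 y)) :
    IsDynSyncProximal f (⋃ j < l, range (φ j)) (f^[i] x) := by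
  refine exists_strictMono_tendsto_zero (p := (0 < ·)) (u := fun t =>
    Metric.ediam (f^[t] '' ((⋃ j < l, range (φ j)) ∪ {f^[i] x}))) fun ε hε => ?_
  have hε2 : 0 < ε / 2 := ENNReal.half_pos hε.ne'
  obtain ⟨hW, hW'⟩ := isOpen_and_nonempty_preimage_eball hy hε2
  have hev := (hlim.eventually_mem (Metric.isOpen_eball.mem_nhds (Metric.mem_eball_self hε2))).and
    ((eventually_gt_atTop 0).filter_mono (atTopIn_le_atTop N))
  refine ((h.frequently_forall_mem hN 0 l hW hW').and_eventually hev).filter_mono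
    (atTopIn_le_atTop N) |>.mono fun t ht => ⟨ht.2.2, ?_⟩
  rw [← isometry_subtype_coe.ediam_image]
  refine ediam_le_of_subset_eball (x := y) ?_
  rintro _ ⟨_, ⟨c, hc | hc, rfl⟩, rfl⟩
  · simp only [mem_iUnion] at hc
    obtain ⟨j, hj, x, rfl⟩ := hc
    exact ht.1 j hj x
  · rw [mem_singleton_iff.1 hc, ← Function.iterate_add_apply]
    exact ht.2.1

/-- Points steered close enough to the fixed point stay near it for `i` and `j` more steps, so
different shifts do no harm. -/
theorem liminf_eq_zero (h : IsSteerable f 𝒩 φ) (hf : Continuous f) {z : I} (hz : f z = z)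
    (hN : N ∈ 𝒩) (p q : ℕ × (ℕ → Bool)) (i j : ℕ) :
    liminf (fun n => edist (f^[n + i] (φ p.1 p.2)) (f^[n + j] (φ q.1 q.2))) (atTopIn N) = 0 := by
  refine liminf_eq_zero_of_frequently fun ε hε => ?_
  have hε2 : 0 < ε / 2 := ENNReal.half_pos hε.ne'
  have hopen : ∀ i, IsOpen (f^[i] ⁻¹' Metric.eball z (ε / 2)) := fun i =>
    Metric.isOpen_eball.preimage (hf.iterate i)
  have hmem : ∀ i, z ∈ f^[i] ⁻¹' Metric.eball z (ε / 2) := fun i => by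
    rw [mem_preimage, Function.iterate_fixed hz]
    exact Metric.mem_eball_self hε2
  refine (h.frequently_forall_mem hN 0 (max p.1 q.1 + 1) ((hopen i).inter (hopen j))
    ⟨z, hmem i, hmem j⟩).mono fun t ht => ?_
  have hp : edist (f^[i] (f^[t + 0] (φ p.1 p.2))) z < ε / 2 :=
    (ht p.1 (Nat.lt_succ_of_le (le_max_left _ _)) p.2).1
  have hq : edist (f^[j] (f^[t + 0] (φ q.1 q.2))) z < ε / 2 :=
    (ht q.1 (Nat.lt_succ_of_le (le_max_right _ _)) q.2).2
  rw [add_zero, ← Function.iterate_add_apply, add_comm] at hp hq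
  refine (edist_triangle_right _ _ z).trans_lt ((ENNReal.add_lt_add hp hq).trans_eq ?_)
  exact ENNReal.add_halves ε

/-- Steer both orbits at time `t + i` close to a point `u` that `f^[j - i]` moves far; at time `t +
j` the second is near the image of `u`. The parameters may coincide. -/
theorem infSupDisplacement_le_limsup_of_lt (h : IsSteerable f 𝒩 φ) (hf : Continuous f)
    (hN : N ∈ 𝒩) (p q : ℕ × (ℕ → Bool)) {i j : ℕ} (hij : i < j) :
    infSupDisplacement f ≤
      limsup (fun n => edist (f^[n + i] (φ p.1 p.2)) (f^[n + j] (φ q.1 q.2))) (atTopIn N) := by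
  refine le_limsup_of_frequently_lt fun b hb => ?_
  obtain ⟨u, hu⟩ := lt_iSup_iff.1 (hb.trans_le (iInf₂_le (j - i) (Nat.sub_pos_of_lt hij)))
  rw [edist_comm] at hu
  obtain ⟨U, V, hU, hV, hxU, hxV, hUV⟩ := exists_isOpen_lt_edist (g := id) continuous_id
    (hf.iterate (j - i)) hu
  refine (h.frequently_forall_mem hN i (max p.1 q.1 + 1) (hU.inter hV) ⟨u, hxU, hxV⟩).mono
    fun t ht => ?_
  have := hUV _ (ht p.1 (Nat.lt_succ_of_le (le_max_left _ _)) p.2).1 _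
    (ht q.1 (Nat.lt_succ_of_le (le_max_right _ _)) q.2).2
  rwa [← Function.iterate_add_apply, show j - i + (t + i) = t + j by omega] at this

theorem infSupDisplacement_le_limsup (h : IsSteerable f 𝒩 φ) (hf : Continuous f)
    (hN : N ∈ 𝒩) {p q : ℕ × (ℕ → Bool)} {i j : ℕ}
    (hne : f^[i] (φ p.1 p.2) ≠ f^[j] (φ q.1 q.2)) :
    infSupDisplacement f ≤
      limsup (fun n => edist (f^[n + i] (φ p.1 p.2)) (f^[n + j] (φ q.1 q.2))) (atTopIn N) := by
  rcases lt_trichotomy i j with hij | rfl | hij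
  · exact h.infSupDisplacement_le_limsup_of_lt hf hN p q hij
  · refine (infSupDisplacement_le_len f).trans (h.len_le_limsup hN i ?_)
    rintro rfl
    exact hne rfl
  · simp only [edist_comm (f^[_ + i] _)]
    exact h.infSupDisplacement_le_limsup_of_lt hf hN q p hij

theorem liminf_eq_zero_of_tendsto (h : IsSteerable f 𝒩 φ) (hN : N ∈ 𝒩) {x : I} {y : ℝ}
    (hy : y ∈ closure I) {j : ℕ}
    (hlim : Tendsto (fun t => (f^[t + j] x : ℝ)) (atTopIn N) (𝓝 y)) (p : ℕ × (ℕ → Bool))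
    (i : ℕ) :
    liminf (fun n => edist (f^[n + j] x) (f^[n + i] (φ p.1 p.2))) atTop = 0 := by
  refine liminf_eq_zero_of_frequently fun ε hε => ?_
  have hε2 : 0 < ε / 2 := ENNReal.half_pos hε.ne'
  obtain ⟨hW, hW'⟩ := isOpen_and_nonempty_preimage_eball hy hε2
  refine ((h.frequently_forall_mem hN i (p.1 + 1) hW hW').and_eventually (hlim.eventually_mem
    (Metric.isOpen_eball.mem_nhds (Metric.mem_eball_self hε2)))).filter_mono
    (atTopIn_le_atTop N) |>.mono fun t ht => ?_
  have hp : edist ((f^[t + i] (φ p.1 p.2) : I) : ℝ) y < ε / 2 := ht.1 p.1 p.1.lt_succ_self p.2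
  have hx : edist ((f^[t + j] x : I) : ℝ) y < ε / 2 := ht.2
  refine (edist_triangle_right ((f^[t + j] x : I) : ℝ) _ y).trans_lt
    ((ENNReal.add_lt_add hx hp).trans_eq ?_)
  exact ENNReal.add_halves ε

/-- Along `N` the orbit of `x` is pinned near `y`, so only the other orbit can be steered. Every `y`
has points of `I` at distance nearly half the length or more. -/
theorem half_len_le_limsup_of_tendsto (h : IsSteerable f 𝒩 φ) (hN : N ∈ 𝒩) {x : I} {y : ℝ}
    {j : ℕ} (hlim : Tendsto (fun t => (f^[t + j] x : ℝ)) (atTopIn N) (𝓝 y))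
    (p : ℕ × (ℕ → Bool)) (i : ℕ) :
    len I / 2 ≤ limsup (fun n => edist (f^[n + j] x) (f^[n + i] (φ p.1 p.2))) atTop := by
  refine le_limsup_of_frequently_lt fun b hb => ?_
  obtain ⟨u, hu⟩ := exists_lt_edist_of_lt_half_len hb y
  obtain ⟨U, V, hU, hV, hyU, huV, hUV⟩ := exists_isOpen_lt_edist (X := ℝ) (g := id) (h := id)
    continuous_id continuous_id hu
  refine ((h.frequently_forall_mem hN i (p.1 + 1) (hV.preimage continuous_subtype_val)
    ⟨u, huV⟩).and_eventually (hlim.eventually_mem (hU.mem_nhds hyU))).filter_mono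
    (atTopIn_le_atTop N) |>.mono fun t ht => ?_
  exact hUV _ ht.2 _ (ht.1 p.1 p.1.lt_succ_self p.2)

end IsSteerable

/-! ### Forward images and the proof of the theorem -/

theorem subset_forwardImages {X : Type*} (f : X → X) (S : Set X) : S ⊆ forwardImages f S :=
  fun x hx => mem_iUnion.2 ⟨0, x, hx, rfl⟩

theorem mapsTo_forwardImages {X : Type*} (f : X → X) (S : Set X) :
    MapsTo f (forwardImages f S) (forwardImages f S) := by
  intro x hx
  obtain ⟨i, c, hc, rfl⟩ := mem_iUnion.1 hx
  exact mem_iUnion.2 ⟨i + 1, c, hc, Function.iterate_succ_apply' f i c⟩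

theorem infinite_setOf_dvd {n : ℕ} (hn : 1 ≤ n) : {t | n ∣ t}.Infinite :=
  Set.infinite_of_forall_exists_gt fun a =>
    ⟨n * (a + 1), Dvd.intro _ rfl, a.lt_succ_self.trans_le (Nat.le_mul_of_pos_left _ hn)⟩

end IntervalDynamics

theorem theorem8 (I : Set ℝ) (hI : I.OrdConnected) (hI' : I.Nontrivial)
    (f : I → I) (hf : Continuous f) (hbi : IsBitransitive f)
    (M : Set ℕ) (hM : M.Infinite) (hMpos : ∀ n ∈ M, 0 < n)
    (V : Set ℝ) (hVc : V.Countable) (hVi : V.Infinite) (hV : V ⊆ closure I)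
    (X : Set I) (hXc : X.Countable) (hXi : X.Infinite)
    (hX : ∀ x ∈ X, ∃ y : ℝ, IsOmegaLimitPoint f x y) :
    0 < infSupDisplacement f ∧
    ∃ S : ℕ → Set I,
      Pairwise (fun i j => Disjoint (S i) (S j)) ∧
      (∀ j, IsCantorSet (Subtype.val '' S j)) ∧
      (∀ j, ∀ x ∈ S j, IsTotallyTransitivePoint f x) ∧
      (∀ U : Set I, IsOpen U → U.Nonempty → {j | S j ⊆ U}.Infinite) ∧
      (∀ l : ℕ, 1 ≤ l →
        (∀ v ∈ V, IsSyncProximal f M (⋃ j < l, S j) v) ∧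
        (∀ x ∈ X, ∀ i : ℕ, IsDynSyncProximal f (⋃ j < l, S j) (f^[i] x))) ∧
      (Dense (⋃ j, S j) ∧ IsScrambledWrt f M (len I) (⋃ j, S j)) ∧
      (∀ x ∈ forwardImages f X, ∀ c ∈ forwardImages f (⋃ j, S j),
        liminf (fun n => edist (f^[n] x) (f^[n] c)) atTop = 0 ∧
        len I / 2 ≤ limsup (fun n => edist (f^[n] x) (f^[n] c)) atTop ∧
        IsScrambled f (len I / 2) {x, c}) ∧
      (∀ c ∈ ⋃ j, S j, ∀ d ∈ ⋃ j, S j, c ≠ d → ∀ i : ℕ,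
        limsup (fun n => edist (f^[n] (f^[i] c)) (f^[n] (f^[i] d))) (atTopIn M) = len I) ∧
      (Dense (forwardImages f (⋃ j, S j)) ∧
        MapsTo f (forwardImages f (⋃ j, S j)) (forwardImages f (⋃ j, S j)) ∧
        IsScrambledWrt f M (infSupDisplacement f) (forwardImages f (⋃ j, S j))) ∧
      (M = {k | ∃ n : ℕ, 1 ≤ n ∧ k = n.factorial} → ∀ n : ℕ, 1 ≤ n →
        (Dense (⋃ j, S j) ∧ IsScrambled (f^[n]) (len I) (⋃ j, S j)) ∧
        Dense (forwardImages f (⋃ j, S j)) ∧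
        MapsTo (f^[n]) (forwardImages f (⋃ j, S j)) (forwardImages f (⋃ j, S j)) ∧
        IsScrambled (f^[n]) (infSupDisplacement f) (forwardImages f (⋃ j, S j))) := by
  have hne : Nonempty I := hI'.nonempty.to_subtype
  have := polishSpace_of_ordConnected hI
  obtain ⟨hmix, z, hz⟩ := hbi.isMixing_and_exists_fixedPt hI hI' hf
  choose! y hy using hX
  have hex : ∀ (x : I) (j : ℕ), ∃ N : Set ℕ, N.Infinite ∧
      (x ∈ X → Tendsto (fun t => (f^[t + j] x : ℝ)) (atTopIn N) (𝓝 (y x))) := by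
    intro x j
    by_cases hx : x ∈ X
    · obtain ⟨N, hN, hlim⟩ := (hy x hx).exists_tendsto j
      exact ⟨N, hN, fun _ => hlim⟩
    · exact ⟨univ, infinite_univ, fun h => absurd h hx⟩
  choose N hN hlim using hex
  -- `M` serves scrambling, the multiples of `n` total transitivity, and `N x j` comparison with the
  -- orbit of `f^[j] x`; countability permits the Baire argument.
  let 𝒩 : Set (Set ℕ) := {M} ∪ (fun n : ℕ => {t | n ∣ t}) '' Ici 1 ∪
    (fun p : I × ℕ => N p.1 p.2) '' (X ×ˢ univ)
  have h𝒩c : 𝒩.Countable := ((countable_singleton M).union ((to_countable _).image _)).union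
    ((hXc.prod (to_countable _)).image _)
  have h𝒩i : ∀ T ∈ 𝒩, T.Infinite := by
    rintro _ ((rfl | ⟨n, hn, rfl⟩) | ⟨p, -, rfl⟩)
    · exact hM
    · exact infinite_setOf_dvd hn
    · exact hN _ _
  have hM𝒩 : M ∈ 𝒩 := Or.inl (Or.inl rfl)
  have hd𝒩 : ∀ n : ℕ, 1 ≤ n → {t | n ∣ t} ∈ 𝒩 := fun n hn => Or.inl (Or.inr ⟨n, hn, rfl⟩)
  have hX𝒩 : ∀ x ∈ X, ∀ j, N x j ∈ 𝒩 := fun x hx j => Or.inr ⟨(x, j), ⟨hx, mem_univ _⟩, rfl⟩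
  obtain ⟨φ, hφ⟩ := hmix.exists_isSteerable hf h𝒩c h𝒩i
  have hinj := hφ.injective hM𝒩 hI'
  have hS : Dense (⋃ j, range (φ j)) := hφ.dense_iUnion_range
  have hmem : ∀ c ∈ ⋃ j, range (φ j), ∃ p : ℕ × (ℕ → Bool), φ p.1 p.2 = c := by
    intro c hc
    obtain ⟨j, x, rfl⟩ := mem_iUnion.1 hc
    exact ⟨(j, x), rfl⟩
  have hSn : (⋃ j, range (φ j)).Nontrivial :=
    ⟨φ 0 default, mem_iUnion.2 ⟨0, mem_range_self _⟩, φ 1 default,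
      mem_iUnion.2 ⟨1, mem_range_self _⟩, fun h => zero_ne_one (congrArg Prod.fst
        (hinj (a₁ := (0, default)) (a₂ := (1, default)) h))⟩
  have hFd := hS.mono (subset_forwardImages f _)
  have hSscr : IsScrambledWrt f M (len I) (⋃ j, range (φ j)) := by
    refine ⟨hSn, fun c hc d hd hcd => ?_⟩
    obtain ⟨p, rfl⟩ := hmem c hc
    obtain ⟨q, rfl⟩ := hmem d hd
    exact ⟨hφ.liminf_eq_zero hf hz hM𝒩 p q 0 0,
      hφ.len_le_limsup hM𝒩 0 (by rintro rfl; exact hcd rfl)⟩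
  have hFscr : IsScrambledWrt f M (infSupDisplacement f)
      (forwardImages f (⋃ j, range (φ j))) := by
    refine ⟨hSn.mono (subset_forwardImages f _), fun c hc d hd hcd => ?_⟩
    obtain ⟨i, _, hc', rfl⟩ := mem_iUnion.1 hc
    obtain ⟨j, _, hd', rfl⟩ := mem_iUnion.1 hd
    obtain ⟨p, rfl⟩ := hmem _ hc'
    obtain ⟨q, rfl⟩ := hmem _ hd'
    simp only [← Function.iterate_add_apply]
    exact ⟨hφ.liminf_eq_zero hf hz hM𝒩 p q i j, hφ.infSupDisplacement_le_limsup hf hM𝒩 hcd⟩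
  refine ⟨hmix.infSupDisplacement_pos hI', fun j => range (φ j), ?_, ?_, ?_,
    hφ.infinite_range_subset, ?_, ⟨hS, hSscr⟩, ?_, ?_,
    ⟨hFd, mapsTo_forwardImages f _, hFscr⟩, ?_⟩
  · intro i j hij
    refine disjoint_left.2 ?_
    rintro _ ⟨x, rfl⟩ ⟨x', hx'⟩
    exact hij (congrArg Prod.fst (hinj (a₁ := (j, x')) (a₂ := (i, x)) hx')).symm
  · intro j
    rw [← range_comp]
    refine isCantorSet_range (continuous_subtype_val.comp (φ j).continuous)
      (Subtype.val_injective.comp fun x x' h => ?_)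
    exact congrArg Prod.snd (hinj (a₁ := (j, x)) (a₂ := (j, x')) h)
  · rintro j _ ⟨x, rfl⟩
    exact hφ.isTotallyTransitivePoint hd𝒩 j x
  · exact fun l _ => ⟨fun v hv => hφ.isSyncProximal hM𝒩 l (hV hv), fun x hx i =>
      hφ.isDynSyncProximal (hX𝒩 x hx i) l (hy x hx).1 (hlim x i hx)⟩
  · intro x hx c hc
    obtain ⟨j, x, hxX, rfl⟩ := mem_iUnion.1 hx
    obtain ⟨i, _, hc', rfl⟩ := mem_iUnion.1 hc
    obtain ⟨p, rfl⟩ := hmem _ hc'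
    have h₁ : liminf (fun n => edist (f^[n] (f^[j] x)) (f^[n] (f^[i] (φ p.1 p.2)))) atTop = 0 := by
      simp only [← Function.iterate_add_apply]
      exact hφ.liminf_eq_zero_of_tendsto (hX𝒩 x hxX j) (hy x hxX).1 (hlim x j hxX) p i
    have h₂ : len I / 2 ≤
        limsup (fun n => edist (f^[n] (f^[j] x)) (f^[n] (f^[i] (φ p.1 p.2)))) atTop := by
      simp only [← Function.iterate_add_apply]
      exact hφ.half_len_le_limsup_of_tendsto (hX𝒩 x hxX j) (hlim x j hxX) p i
    exact ⟨h₁, h₂, isScrambled_pair (ENNReal.half_pos (len_pos hI').ne') h₁ h₂⟩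
  · intro c hc d hd hcd i
    obtain ⟨p, rfl⟩ := hmem c hc
    obtain ⟨q, rfl⟩ := hmem d hd
    simp only [← Function.iterate_add_apply]
    exact le_antisymm (limsup_le_of_le (h := Eventually.of_forall fun _ => edist_le_len _ _))
      (hφ.len_le_limsup hM𝒩 i (by rintro rfl; exact hcd rfl))
  · rintro rfl n hn
    exact ⟨⟨hS, hSscr.isScrambled_iterate hn⟩, hFd, (mapsTo_forwardImages f _).iterate n,
      hFscr.isScrambled_iterate hn⟩
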